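/- All graphs are simple. For a finite connected graph $G$, the burning number $b(G)$ is the least $m$ such that $G$ can be entirely on fire at the end of step $m$ of the following process: at step $1$ a vertex is set on fire; at every step $i\ge 2$, all neighbours of vertices on fire catch fire, and then a new vertex (one not yet on fire, if there is any) is set on fire. The growth of $G$ is the smallest $k$ such that all vertices of $G$ are within distance $k$ of some path in $G$. A $k$-caterpillar is a finite tree of growth at most $k$. **Theorem.** For every integer $k\ge 0$, either every $k$-caterpillar $T$ satisfies $b(T)\le\lceil\sqrt{|V(T)|}\,\rceil$, or there is a $k$-caterpillar $T$ with $|V(T)|\le(4k^2+5k+4)^2$ and $b(T)>\lceil\sqrt{|V(T)|}\,\rceil$. In other words, if $b(T)\le\lceil\sqrt{|V(T)|}\,\rceil$ holds for all trees of growth at most $k$ on at most $(4k^2+5k+4)^2$ vertices, then it holds for all trees of growth at most $k$. -/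

import Mathlib

namespace GraphBurning

variable {V : Type*}

/-- The vertices on fire once all neighbours of the vertices of `S` have caught fire. -/
def spread (G : SimpleGraph V) (S : Set V) : Set V :=
  {v | v ∈ S ∨ ∃ u ∈ S, G.Adj u v}

/-- The set of vertices on fire at the end of step `i` of the burning process, when `x j` is the
vertex set on fire at step `j + 1`: at each step the fire first spreads to all neighbours of burning
vertices (nothing burns before step `1`), then the chosen vertex is set on fire. -/
def fireAfter (G : SimpleGraph V) (x : ℕ → V) : ℕ → Set V
  | 0 => ∅
  | i + 1 => spread G (fireAfter G x i) ∪ {x i}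

/-- `G` is `m`-burnable: vertices can be chosen so that at the end of step `m` the whole graph is on
fire. The vertex chosen at each step is new, i.e. not yet on fire, as long as there is such a
vertex. -/
def IsBurnable (G : SimpleGraph V) (m : ℕ) : Prop :=
  ∃ x : ℕ → V,
    (∀ i < m, spread G (fireAfter G x i) ≠ Set.univ → x i ∉ spread G (fireAfter G x i)) ∧
    fireAfter G x m = Set.univ

/-- The burning number `b(G)`: the least `m` such that `G` is `m`-burnable. -/
noncomputable def burningNumber (G : SimpleGraph V) : ℕ :=
  sInf {m | IsBurnable G m}

/-- Some path of `G` has every vertex of `G` within distance `k` of it. -/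
def HasSpineWithin (G : SimpleGraph V) (k : ℕ) : Prop :=
  ∃ (u v : V) (p : G.Walk u v), p.IsPath ∧ ∀ w : V, ∃ z ∈ p.support, G.dist w z ≤ k

/-- The growth of a connected graph: the least `k` such that all its vertices are within distance
`k` of some path. -/
noncomputable def growth (G : SimpleGraph V) : ℕ :=
  sInf {k | HasSpineWithin G k}

/-- A `k`-caterpillar is a tree of growth at most `k`. -/
def IsKCaterpillar (k : ℕ) (T : SimpleGraph V) : Prop :=
  T.IsTree ∧ growth T ≤ k

/-- The inequality `b(G) ≤ ⌈√|V(G)|⌉` of the burning conjecture, for the graph `G`. -/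
def BurningConjectureHoldsFor (G : SimpleGraph V) : Prop :=
  burningNumber G ≤ ⌈Real.sqrt (Nat.card V)⌉₊

/-- Every finite nonempty graph is `m`-burnable for some `m`, so the burning number of such a graph
is an attained minimum. -/
theorem exists_isBurnable [Finite V] [Nonempty V] (G : SimpleGraph V) : ∃ m, IsBurnable G m := by
  classical
  have hp : ∀ S : Set V, ∃ v : V, S ≠ Set.univ → v ∉ S := by
    intro S
    by_cases h : S = Set.univ
    · exact ⟨Classical.arbitrary V, fun h' => absurd h h'⟩
    · obtain ⟨v, hv⟩ := (Set.ne_univ_iff_exists_notMem S).1 h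
      exact ⟨v, fun _ => hv⟩
  choose pick hpick using hp
  let s : ℕ → Set V := fun n =>
    Nat.rec ∅ (fun _ S => spread G S ∪ {pick (spread G S)}) n
  let x : ℕ → V := fun n => pick (spread G (s n))
  have hs : ∀ n, fireAfter G x n = s n := by
    intro n
    induction n with
    | zero => rfl
    | succ n ih => simp only [fireAfter, ih]; rfl
  have hsub : ∀ S : Set V, S ⊆ spread G S := fun S v hv => Or.inl hv
  have hcard : ∀ n, fireAfter G x n = Set.univ ∨ n ≤ (fireAfter G x n).ncard := by
    intro n
    induction n with
    | zero => exact Or.inr (Nat.zero_le _)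
    | succ n ih =>
      by_cases hu : spread G (fireAfter G x n) = Set.univ
      · left
        simp [fireAfter, hu]
      · right
        have hn : n ≤ (fireAfter G x n).ncard := by
          rcases ih with ih | ih
          · exact absurd (Set.univ_subset_iff.1 (ih ▸ hsub (fireAfter G x n))) hu
          · exact ih
        have hx : x n ∉ spread G (fireAfter G x n) := by
          rw [hs] at hu ⊢
          exact hpick _ hu
        have h1 := Set.ncard_le_ncard (hsub (fireAfter G x n)) (Set.toFinite _)
        have h2 := Set.ncard_insert_of_notMem hx (Set.toFinite _)
        have h3 : fireAfter G x (n + 1) = insert (x n) (spread G (fireAfter G x n)) := by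
          simp [fireAfter]
        rw [h3, h2]
        omega
  refine ⟨Nat.card V + 1, x, fun i _ h => ?_, ?_⟩
  · rw [hs] at h ⊢
    exact hpick _ h
  · rcases hcard (Nat.card V + 1) with h | h
    · exact h
    · have := Set.ncard_le_card (fireAfter G x (Nat.card V + 1))
      omega

/-- For a finite nonempty graph the growth is an attained minimum. -/
theorem exists_hasSpineWithin [Finite V] [Nonempty V] (G : SimpleGraph V) :
    ∃ k, HasSpineWithin G k := by
  let u : V := Classical.arbitrary V
  obtain ⟨k, hk⟩ := (Set.finite_range fun w : V => G.dist w u).bddAbove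
  exact ⟨k, u, u, SimpleGraph.Walk.nil, SimpleGraph.Walk.IsPath.nil,
    fun w => ⟨u, by simp, hk ⟨w, rfl⟩⟩⟩

end GraphBurning

/-! Burning in `m` steps is covering by balls of radii `0, …, m - 1` (`isBurnable_iff`), so the
claim becomes: at most `m ^ 2` vertices can be covered by these balls. Induct on the number of
vertices. It suffices that, once `m ≥ 4k² + 5k + 5`, the `J ≥ 1` largest balls cover an initial part
of the tree with at least `m ^ 2 - (m - J) ^ 2` vertices (`separable_of_le`): the rest is a smaller
`k`-caterpillar for the remaining balls.

A vertex at height `h` attached at position `i` casts the shadow `[i - h, i + h]`; a ball centred on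
the spine catches it if it contains this shadow. Balls are laid end to end. Ball `p` covers `2m - 1
- 2p` positions, and these lengths sum to the required number of vertices, so only overlaps forced
by cut shadows are lost, and vertices off the spine must pay for them.

An overlap is at most `2k` long. The next ball may be chosen among the `2k + 1` largest unused ones,
whose cuts have equal parity. Bad cuts of one parity yield distinct vertices off the spine: if all
are bad, these exceed the loss by one; otherwise a ball with a good cut is used, and the bad cuts
skipped over add to the surplus (`State.separable_or_exists`). Either the used balls become exactly
the largest ones with all losses paid, or the surplus grows until it pays `k` for each of the at
most `2k` skipped balls (`State.separable_of_surplus`). -/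

namespace GraphBurning

/-! ### Shadows, cuts and the placing of one ball, for integer positions and heights. -/

section Combinatorics

variable {V : Type*} [Fintype V] (pos ht : V → ℤ) (m : ℕ)

/-- The balls with centres `c p` and radii `m - 1 - p` for `p ∈ U` contain `w`. -/
def Caught (c : ℕ → ℤ) (U : Finset ℕ) (w : V) : Prop :=
  ∃ p ∈ U, |pos w - c p| + ht w ≤ m - 1 - p

/-- All vertices that are not caught have their shadow on the spine at or after position `B`. -/
def CatchesBefore (U : Finset ℕ) (B : ℤ) : Prop :=
  ∃ c : ℕ → ℤ, ∀ w, Caught pos ht m c U w ∨ B ≤ pos w - ht w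

/-- The cut before position `b` separates the shadow of some vertex. -/
def IsBad (b : ℤ) : Prop := ∃ w, pos w - ht w < b ∧ b ≤ pos w + ht w

/-- The number of vertices off the spine that are attached before position `x`. -/
noncomputable def legs (x : ℤ) : ℕ := by
  classical exact (Finset.univ.filter fun w => 0 < ht w ∧ pos w < x).card

/-- An initial part of the graph can be burnt with the `J` largest balls, and what is left has at
most `(m - J) ^ 2` vertices if the whole graph has at most `m ^ 2`. -/
def Separable : Prop :=
  ∃ (J : ℕ) (s : ℤ) (c : ℕ → ℤ), 1 ≤ J ∧ J ≤ m ∧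
    (∀ w, pos w < s → Caught pos ht m c (Finset.range J) w) ∧
    ((∀ w, pos w < s) ∨ (J : ℤ) * (2 * m - J) ≤ Nat.card {w // pos w < s})

variable {pos ht m}

theorem legs_mono {x y : ℤ} (hxy : x ≤ y) : legs pos ht x ≤ legs pos ht y := by
  classical
  unfold legs
  refine Finset.card_le_card fun w hw => ?_
  simp only [Finset.mem_filter, Finset.mem_univ, true_and] at hw ⊢
  omega

theorem legs_add_card_le {x y : ℤ} (F : Finset V) (hF : ∀ w ∈ F, 0 < ht w ∧ x ≤ pos w ∧ pos w < y)
    (hxy : x ≤ y) : legs pos ht x + F.card ≤ legs pos ht y := by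
  classical
  unfold legs
  rw [← Finset.card_union_of_disjoint]
  · refine Finset.card_le_card fun w hw => ?_
    simp only [Finset.mem_union, Finset.mem_filter, Finset.mem_univ, true_and] at hw ⊢
    rcases hw with hw | hw
    · omega
    · have := hF w hw; omega
  · rw [Finset.disjoint_left]
    intro w hw hw'
    simp only [Finset.mem_filter, Finset.mem_univ, true_and] at hw
    have := hF w hw'; omega

variable (hfib : ∀ w d, 0 ≤ d → d ≤ ht w → ∃ w', pos w' = pos w ∧ ht w' = d)
  (hht : ∀ w, 0 ≤ ht w)

include hfib in
/-- A vertex at height `ht w` comes with `ht w` vertices off the spine. -/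
theorem legs_add_height_le {x y : ℤ} (w : V) (hx : x ≤ pos w) (hy : pos w < y) :
    legs pos ht x + ht w ≤ legs pos ht y := by
  classical
  by_cases h0 : ht w ≤ 0
  · have := legs_mono (pos := pos) (ht := ht) (show x ≤ y by omega); omega
  have : Nonempty V := ⟨w⟩
  choose! f hf1 hf2 using hfib w
  have hinj : Set.InjOn f ((Finset.Icc 1 (ht w) : Finset ℤ) : Set ℤ) := by
    intro a ha b hb hab
    simp only [Finset.coe_Icc, Set.mem_Icc] at ha hb
    rw [← hf2 a (by omega) (by omega), ← hf2 b (by omega) (by omega), hab]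
  have h := legs_add_card_le (pos := pos) (ht := ht) (x := x) (y := y)
    ((Finset.Icc 1 (ht w)).image f) (by
      intro v hv
      simp only [Finset.mem_image, Finset.mem_Icc] at hv
      obtain ⟨a, ha, rfl⟩ := hv
      rw [hf1 a (by omega) (by omega), hf2 a (by omega) (by omega)]
      omega) (by omega)
  rw [Finset.card_image_of_injOn hinj, Int.card_Icc] at h
  omega

include hfib in
/-- Bad cuts of the same parity are paid for by distinct vertices off the spine. -/
theorem legs_add_card_bad_le {k : ℕ} (hk : ∀ w, ht w ≤ k) {x y e : ℤ} (K : Finset ℕ)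
    (hbad : ∀ p ∈ K, IsBad pos ht (e - 2 * p)) (hx : ∀ p ∈ K, x + k ≤ e - 2 * p)
    (hy : ∀ p ∈ K, e - 2 * p + k ≤ y) (hxy : x ≤ y) :
    legs pos ht x + K.card ≤ legs pos ht y := by
  classical
  -- To each bad cut belongs the lowest vertex, below one with a cut shadow, whose shadow is still
  -- cut there.
  have key : ∀ p ∈ K, ∃ v : V, (0 < ht v ∧ x ≤ pos v ∧ pos v < y) ∧
      ((0 < e - 2 * p - pos v ∧ ht v = e - 2 * p - pos v) ∨
        (e - 2 * p - pos v ≤ 0 ∧ ht v = 1 - (e - 2 * p - pos v))) := by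
    intro p hp
    obtain ⟨w, hw1, hw2⟩ := hbad p hp
    have h1 := hx p hp
    have h2 := hy p hp
    have h3 := hk w
    by_cases hpos : 0 < e - 2 * p - pos w
    · obtain ⟨v, hv1, hv2⟩ := hfib w (e - 2 * p - pos w) (by omega) (by omega)
      exact ⟨v, by omega, by omega⟩
    · obtain ⟨v, hv1, hv2⟩ := hfib w (1 - (e - 2 * p - pos w)) (by omega) (by omega)
      exact ⟨v, by omega, by omega⟩
  rcases K.eq_empty_or_nonempty with rfl | ⟨p₀, hp₀⟩
  · simpa using legs_mono hxy
  have : Nonempty V := ⟨(key p₀ hp₀).choose⟩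
  choose! f hf1 hf2 using key
  -- A vertex `v` can only serve the cuts `pos v + ht v` and `pos v - ht v + 1`; they differ by an
  -- odd number, so at most one has the parity of `e`.
  have hinj : Set.InjOn f (K : Set ℕ) := by
    intro a ha b hb hab
    have h1 := hf2 a ha
    have h2 := hf2 b hb
    rw [hab] at h1
    omega
  have h := legs_add_card_le (pos := pos) (ht := ht) (x := x) (y := y) (K.image f) (by
      intro v hv
      obtain ⟨a, ha, rfl⟩ := Finset.mem_image.1 hv
      exact hf1 a ha) hxy
  rwa [Finset.card_image_of_injOn hinj] at h

omit [Fintype V] in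
/-- Using one more ball, placed as early as possible. -/
theorem exists_catches_insert {U : Finset ℕ} {B : ℤ} {c : ℕ → ℤ}
    (hB : ∀ w, Caught pos ht m c U w ∨ B ≤ pos w - ht w) {p : ℕ} (hp : p ∉ U) :
    ∃ c', ∀ w, Caught pos ht m c' (insert p U) w ∨
      (B ≤ pos w - ht w ∧ B + (2 * m - 1 - 2 * p) ≤ pos w + ht w) := by
  classical
  -- With this centre the ball covers exactly the positions from `B` to `B + 2m - 2 - 2p`.
  refine ⟨Function.update c p (B + m - 1 - p), fun w => ?_⟩
  rcases hB w with ⟨q, hq, hw⟩ | hw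
  · left
    refine ⟨q, Finset.mem_insert_of_mem hq, ?_⟩
    have hne : q ≠ p := by rintro rfl; exact hp hq
    rwa [Function.update_of_ne hne]
  · by_cases h : B + (2 * m - 1 - 2 * p) ≤ pos w + ht w
    · exact Or.inr ⟨hw, h⟩
    · left
      refine ⟨p, Finset.mem_insert_self _ _, ?_⟩
      rw [Function.update_self]
      have : |pos w - (B + m - 1 - p)| ≤ m - 1 - p - ht w := abs_le.2 ⟨by omega, by omega⟩
      omega

/-- If the end `b` of the new ball cuts shadows, the next ball has to start where the earliest of
them starts. As that shadow reaches `b`, the overlap `l` is at most its length. -/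
theorem CatchesBefore.exists_insert {U : Finset ℕ} {B b : ℤ} (hB : CatchesBefore pos ht m U B)
    {p : ℕ} (hp : p ∉ U) (hb : b = B + (2 * m - 1 - 2 * p)) :
    ∃ l : ℤ, 0 ≤ l ∧ CatchesBefore pos ht m (insert p U) (b - l) ∧
      (l = 0 ∨ ∃ w, pos w - ht w < b ∧ b ≤ pos w + ht w ∧ l ≤ 2 * ht w) := by
  classical
  obtain ⟨c, hc⟩ := hB
  obtain ⟨c', hc'⟩ := exists_catches_insert hc hp
  by_cases hbad : IsBad pos ht b
  · obtain ⟨w, hw, hmin⟩ := Finset.exists_min_image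
      (Finset.univ.filter fun w => pos w - ht w < b ∧ b ≤ pos w + ht w) (fun w => pos w - ht w)
      (by obtain ⟨w, hw⟩ := hbad; exact ⟨w, by simpa using hw⟩)
    simp only [Finset.mem_filter, Finset.mem_univ, true_and] at hw hmin
    refine ⟨b - (pos w - ht w), by omega, ⟨c', fun v => ?_⟩, Or.inr ⟨w, hw.1, hw.2, by omega⟩⟩
    rcases hc' v with h | h
    · exact Or.inl h
    · right
      by_cases hv : pos v - ht v < b
      · have := hmin v ⟨hv, by omega⟩; omega
      · omega
  · refine ⟨0, le_rfl, ⟨c', fun v => ?_⟩, Or.inl rfl⟩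
    rcases hc' v with h | h
    · exact Or.inl h
    · right
      by_contra hv
      exact hbad ⟨v, by omega, by omega⟩

theorem sum_range_ball (m J : ℕ) :
    ∑ p ∈ Finset.range J, (2 * m - 1 - 2 * p : ℤ) = J * (2 * m - J) := by
  induction J with
  | zero => simp
  | succ n ih => rw [Finset.sum_range_succ, ih]; push_cast; ring

variable (hspine : ∀ w i, 0 ≤ i → i ≤ pos w → ∃ w', pos w' = i ∧ ht w' = 0)
  (hpos : ∀ w, 0 ≤ pos w)

-- The initial part ends at the first position of an uncaught vertex. It contains the spine up to
-- there, at least `x` vertices, and all legs before `y`.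
include hspine hpos in
theorem separable_of_caught {J : ℕ} (hJ : 1 ≤ J) (hJm : J ≤ m) {c : ℕ → ℤ} {x y : ℤ}
    (hc : ∀ w, Caught pos ht m c (Finset.range J) w ∨ x ≤ pos w) (hy : y ≤ x)
    (hcard : (J : ℤ) * (2 * m - J) ≤ x + legs pos ht y) : Separable pos ht m := by
  classical
  by_cases hall : ∀ w, Caught pos ht m c (Finset.range J) w
  · obtain ⟨M, hM⟩ := (Set.finite_range pos).bddAbove
    exact ⟨J, M + 1, c, hJ, hJm, fun w _ => hall w,
      Or.inl fun w => by have := hM ⟨w, rfl⟩; omega⟩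
  · push Not at hall
    obtain ⟨w, hw, hmin⟩ := Finset.exists_min_image
      (Finset.univ.filter fun w => ¬ Caught pos ht m c (Finset.range J) w) pos
      (by obtain ⟨w, hw⟩ := hall; exact ⟨w, by simpa using hw⟩)
    simp only [Finset.mem_filter, Finset.mem_univ, true_and] at hw hmin
    refine ⟨J, pos w, c, hJ, hJm, fun v hv => ?_, Or.inr (hcard.trans ?_)⟩
    · by_contra h
      have := hmin v h; omega
    · have hxw : x ≤ pos w := (hc w).resolve_left hw
      have : Nonempty V := ⟨w⟩
      choose! f hf1 hf2 using hspine w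
      have hinj : Set.InjOn f ((Finset.Ico 0 (pos w) : Finset ℤ) : Set ℤ) := by
        intro a ha b hb hab
        simp only [Finset.coe_Ico, Set.mem_Ico] at ha hb
        rw [← hf1 a (by omega) (by omega), ← hf1 b (by omega) (by omega), hab]
      have hdisj : Disjoint ((Finset.Ico 0 (pos w)).image f)
          (Finset.univ.filter fun v => 0 < ht v ∧ pos v < y) := by
        rw [Finset.disjoint_left]
        intro v hv hv'
        simp only [Finset.mem_image, Finset.mem_Ico, Finset.mem_filter, Finset.mem_univ,
          true_and] at hv hv'
        obtain ⟨a, ha, rfl⟩ := hv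
        have := hf2 a (by omega) (by omega); omega
      have hle := Finset.card_le_card (s := ((Finset.Ico 0 (pos w)).image f) ∪
          (Finset.univ.filter fun v => 0 < ht v ∧ pos v < y))
          (t := Finset.univ.filter fun v => pos v < pos w) (by
        intro v hv
        simp only [Finset.mem_union, Finset.mem_image, Finset.mem_Ico, Finset.mem_filter,
          Finset.mem_univ, true_and] at hv ⊢
        rcases hv with ⟨a, ha, rfl⟩ | hv
        · have := hf1 a (by omega) (by omega); omega
        · omega)
      rw [Finset.card_union_of_disjoint hdisj, Finset.card_image_of_injOn hinj, Int.card_Ico]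
        at hle
      rw [Nat.card_eq_fintype_card, Fintype.card_subtype]
      have := hpos w
      simp only [legs]
      omega

end Combinatorics

end GraphBurning

/-! ### The burning procedure and its bookkeeping of losses and surplus. -/

namespace GraphBurning

section Procedure

variable {V : Type*} [Fintype V]

/-- The state of the burning procedure: the balls indexed by `U` have been used, everything whose
shadow starts before position `B` is covered, a total length of `D` has been lost to overlaps, and
after paying for the loss there is a surplus of `S` vertices off the spine attached before `x`. -/
structure State (pos ht : V → ℤ) (m : ℕ) (U : Finset ℕ) (B D x S : ℤ) : Prop where
  catches : CatchesBefore pos ht m U B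
  sum_eq : B + D = ∑ p ∈ U, (2 * m - 1 - 2 * p : ℤ)
  paid : S + D ≤ legs pos ht x

variable {pos ht : V → ℤ} {m k : ℕ} {U : Finset ℕ} {B D x S : ℤ}

theorem State.exists_insert (hs : State pos ht m U B D x S) {p : ℕ} (hp : p ∉ U) {b : ℤ}
    (hb : b = B + (2 * m - 1 - 2 * p)) :
    ∃ l : ℤ, 0 ≤ l ∧ (l = 0 ∨ ∃ w, pos w - ht w < b ∧ b ≤ pos w + ht w ∧ l ≤ 2 * ht w) ∧
      ∀ x' S', S' + D + l ≤ legs pos ht x' →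
        State pos ht m (insert p U) (b - l) (D + l) x' S' := by
  obtain ⟨l, hl0, hl, hw⟩ := hs.catches.exists_insert hp hb
  refine ⟨l, hl0, hw, fun x' S' h => ⟨hl, ?_, by omega⟩⟩
  rw [Finset.sum_insert hp, ← hs.sum_eq]
  omega

variable (hfib : ∀ w d, 0 ≤ d → d ≤ ht w → ∃ w', pos w' = pos w ∧ ht w' = d)
  (hht : ∀ w, 0 ≤ ht w) (hk : ∀ w, ht w ≤ k)
  (hspine : ∀ w i, 0 ≤ i → i ≤ pos w → ∃ w', pos w' = i ∧ ht w' = 0)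
  (hpos : ∀ w, 0 ≤ pos w)

include hht hspine hpos in
theorem State.separable {J : ℕ} (hs : State pos ht m (Finset.range J) B D x S) (hJ : 1 ≤ J)
    (hJm : J ≤ m) (hS : 0 ≤ S) (hx : x ≤ B) : Separable pos ht m := by
  obtain ⟨⟨c, hc⟩, hsum, hpaid⟩ := hs
  refine separable_of_caught hspine hpos hJ hJm (c := c) (x := B) (y := x) (fun w => ?_) hx ?_
  · rcases hc w with h | h
    · exact Or.inl h
    · right; have := hht w; omega
  · rw [← sum_range_ball, ← hsum]
    omega

-- For the last ball, uncaught vertices need only be attached late; their shadows may start earlier.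
-- This costs at most `k` positions instead of `2k`.
include hk hspine hpos in
theorem State.separable_of_insert {J : ℕ} (hs : State pos ht m U B D x S) {p : ℕ} (hp : p ∉ U)
    (hU : insert p U = Finset.range J) (hJ : 1 ≤ J) (hJm : J ≤ m) (hS : k ≤ S)
    (hx : x + k ≤ B + (2 * m - 1 - 2 * p)) : Separable pos ht m := by
  obtain ⟨⟨c, hc⟩, hsum, hpaid⟩ := hs
  obtain ⟨c', hc'⟩ := exists_catches_insert hc hp
  refine separable_of_caught hspine hpos hJ hJm (c := c') (x := B + (2 * m - 1 - 2 * p) - k)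
    (y := x) (fun w => ?_) (by omega) ?_
  · rw [← hU]
    rcases hc' w with h | h
    · exact Or.inl h
    · right; have := hk w; omega
  · rw [← sum_range_ball, ← hU, Finset.sum_insert hp, ← hsum]
    omega

include hfib hk hspine hpos in
/-- A large enough surplus allows all skipped balls to be used. -/
theorem State.separable_of_surplus {J : ℕ} (hJm : 2 * J + 4 * k ≤ 2 * m + 1) (g : ℕ) :
    ∀ {U : Finset ℕ} {B D x S : ℤ}, State pos ht m U B D x S → U ⊆ Finset.range J →
      U.card + (g + 1) = J → (k * (g + 1) : ℤ) ≤ S → x + k ≤ B + (2 * m + 1 - 2 * J) →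
      Separable pos ht m := by
  induction g with
  | zero =>
    intro U B D x S hs hU hcard hS hx
    obtain ⟨p, hpJ, hpU⟩ := Finset.exists_mem_notMem_of_card_lt_card
      (s := U) (t := Finset.range J) (by rw [Finset.card_range]; omega)
    have hpJ' := Finset.mem_range.1 hpJ
    refine hs.separable_of_insert hk hspine hpos hpU (J := J) ?_ (by omega) (by omega)
      (by push_cast at hS; linarith) (by omega)
    apply Finset.eq_of_subset_of_card_le (Finset.insert_subset hpJ hU)
    rw [Finset.card_insert_of_notMem hpU, Finset.card_range]
    omega
  | succ g ih =>
    intro U B D x S hs hU hcard hS hx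
    obtain ⟨p, hpJ, hpU⟩ := Finset.exists_mem_notMem_of_card_lt_card
      (s := U) (t := Finset.range J) (by rw [Finset.card_range]; omega)
    have hpJ' := Finset.mem_range.1 hpJ
    have hU' := Finset.insert_subset hpJ hU
    have hc' := Finset.card_insert_of_notMem hpU
    have hS' : (k * (g + 1) : ℤ) + k ≤ S := by push_cast at hS; linarith
    obtain ⟨l, hl0, hl, hnew⟩ := hs.exists_insert hpU rfl
    have hpaid := hs.paid
    rcases hl with rfl | ⟨w, hw1, hw2, hw3⟩
    · exact ih (hnew x S (by omega)) hU' (by omega) (by omega) (by omega)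
    -- The loss is at most `2 * ht w`, but `w` itself is attached at or after `x` and brings `ht w`
    -- new legs, so the net cost is at most `k`.
    · have hkw := hk w
      have := legs_add_height_le hfib (x := x) (y := pos w + 1) w (by omega) (by omega)
      exact ih (hnew (pos w + 1) (S - k) (by omega)) hU' (by omega) (by omega) (by omega)

include hfib hht hk hspine hpos in
/-- One step of the phase in which a surplus is built up. -/
theorem State.separable_or_exists {t g : ℕ} (hs : State pos ht m U B D x S) (hcard : U.card = t)
    (hU : U ⊆ Finset.range (t + g)) (hg : g ≤ 2 * k) (hS : ((t + (g - 1) : ℕ) : ℤ) ≤ S)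
    (hx : x ≤ B + 2 * m - 1 - 2 * t - 5 * k) (htm : 2 * t + 5 * k + 4 ≤ m) :
    Separable pos ht m ∨ ∃ (U' : Finset ℕ) (g' : ℕ) (B' D' x' S' : ℤ),
      State pos ht m U' B' D' x' S' ∧ U'.card = t + 1 ∧ U' ⊆ Finset.range (t + 1 + g') ∧
      g' ≤ 2 * k ∧ ((t + 1 + (g' - 1) : ℕ) : ℤ) ≤ S' ∧
      x' ≤ B' + 2 * m - 1 - 2 * (t + 1 : ℕ) - 5 * k := by
  classical
  have hpaid := hs.paid
  -- The candidates. Their cuts lie at least `k` after `x`, since `p ≤ t + 2k` and `hx` reserves `5k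
  -- = 4k + k`; so the legs paying for bad cuts have not been counted before.
  set A := Finset.range (t + 2 * k + 1) \ U with hA
  have hAU : U ⊆ Finset.range (t + 2 * k + 1) :=
    hU.trans (Finset.range_subset_range.2 (by omega))
  have hAcard : A.card = 2 * k + 1 := by
    rw [hA, Finset.card_sdiff_of_subset hAU, Finset.card_range]; omega
  have hmemA : ∀ p, p ∈ A ↔ p < t + 2 * k + 1 ∧ p ∉ U := fun p => by simp [hA]
  have hcount : ∀ K ⊆ A, (∀ p ∈ K, IsBad pos ht (B + (2 * m - 1) - 2 * p)) →
      (legs pos ht x : ℤ) + K.card ≤ legs pos ht (B + (2 * m - 1) + k) := by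
    intro K hK hbad
    have := legs_add_card_bad_le hfib hk (x := x) (y := B + (2 * m - 1) + k) K hbad
      (fun p hp => by have := (hmemA p).1 (hK hp); omega) (fun p hp => by omega) (by omega)
    exact_mod_cast this
  by_cases hall : ∀ p ∈ A, IsBad pos ht (B + (2 * m - 1) - 2 * p)
  · right
    have hc := hcount A subset_rfl hall
    -- All `2k + 1` candidates are bad: filling a gap loses at most `2k`, so the surplus grows by at
    -- least one.
    obtain ⟨p, hpt, hpU⟩ := Finset.exists_mem_notMem_of_card_lt_card
      (s := U) (t := Finset.range (t + 1)) (by rw [Finset.card_range]; omega)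
    have hpt' := Finset.mem_range.1 hpt
    obtain ⟨l, hl0, hl, hnew⟩ := hs.exists_insert hpU rfl
    have hl2 : l ≤ 2 * k := by
      rcases hl with rfl | ⟨w, -, -, hw⟩
      · positivity
      · have := hk w; omega
    refine ⟨insert p U, g - 1, _, _, B + (2 * m - 1) + k, S + 1,
      hnew _ _ (by omega), by rw [Finset.card_insert_of_notMem hpU, hcard],
      Finset.insert_subset ?_ ?_, by omega, by omega, by omega⟩
    · exact Finset.mem_range.2 (by omega)
    · exact hU.trans (Finset.range_subset_range.2 (by omega))
  · push Not at hall
    obtain ⟨p, hp, hmin⟩ := Finset.exists_min_image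
      (A.filter fun p : ℕ => ¬ IsBad pos ht (B + (2 * m - 1) - 2 * p)) id
      (by obtain ⟨p, hp⟩ := hall; exact ⟨p, by simpa using hp⟩)
    simp only [Finset.mem_filter, id] at hp hmin
    obtain ⟨hpA, hgood⟩ := hp
    obtain ⟨hpt, hpU⟩ := (hmemA p).1 hpA
    set K := A.filter (· < p) with hK
    have hKA : K ⊆ A := Finset.filter_subset _ _
    have hc := hcount K hKA (fun q hq => by
      obtain ⟨hqA, hqp⟩ := Finset.mem_filter.1 hq
      by_contra hbad
      have := hmin q ⟨hqA, hbad⟩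
      omega)
    -- Every index below `p` is used or was skipped for a bad cut.
    have hpK : p ≤ t + K.card := by
      rw [← hcard]
      calc p = (Finset.range p).card := (Finset.card_range p).symm
        _ ≤ (U ∪ K).card := Finset.card_le_card fun q hq => by
            have hqp := Finset.mem_range.1 hq
            by_cases hqU : q ∈ U
            · exact Finset.mem_union_left _ hqU
            · exact Finset.mem_union_right _ (Finset.mem_filter.2
                ⟨(hmemA q).2 ⟨by omega, hqU⟩, hqp⟩)
        _ ≤ _ := Finset.card_union_le _ _
    have hKlt : K.card < A.card := Finset.card_lt_card
      ⟨hKA, fun h => by have := Finset.mem_filter.1 (h hpA); omega⟩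
    obtain ⟨l, hl0, hl, hnew⟩ := hs.exists_insert hpU
      (b := B + (2 * m - 1) - 2 * p) (by omega)
    have hl' : l = 0 := hl.resolve_right fun ⟨w, h1, h2, _⟩ => hgood ⟨w, h1, h2⟩
    clear hl
    subst hl'
    have hcard' : (insert p U).card = t + 1 := by rw [Finset.card_insert_of_notMem hpU, hcard]
    obtain ⟨q, hq1, hq2, hq3⟩ : ∃ q, g - 1 ≤ q ∧ K.card ≤ q ∧ (q = g - 1 ∨ q = K.card) :=
      ⟨max (g - 1) K.card, le_max_left _ _, le_max_right _ _, max_choice _ _⟩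
    have hsub : insert p U ⊆ Finset.range (t + 1 + q) :=
      Finset.insert_subset (Finset.mem_range.2 (by omega))
        (hU.trans (Finset.range_subset_range.2 (by omega)))
    -- No gap is left, so the used balls are exactly the `t + 1` largest.
    by_cases h0 : q = 0
    · left
      have hst := hnew x S (by omega)
      rw [h0, Nat.add_zero] at hsub
      rw [Finset.eq_of_subset_of_card_le hsub (by rw [Finset.card_range, hcard'])] at hst
      exact hst.separable hht hspine hpos (by omega) (by omega) (by omega) (by omega)
    · right
      exact ⟨insert p U, q, _, _, B + (2 * m - 1) + k, S + K.card,
        hnew _ _ (by omega), hcard', hsub, by omega, by omega, by omega⟩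

include hfib hk hpos in
/-- The initial state: a shadow reaching beyond the beginning of the spine is a loss. -/
theorem exists_state_empty : ∃ B D : ℤ, State pos ht m ∅ B D (k + 1) 0 ∧ -(k : ℤ) ≤ B := by
  classical
  by_cases hneg : ∃ w, pos w - ht w < 0
  · obtain ⟨w, hw, hmin⟩ := Finset.exists_min_image
      (Finset.univ.filter fun w => pos w - ht w < 0) (fun w => pos w - ht w)
      (by obtain ⟨w, hw⟩ := hneg; exact ⟨w, by simpa using hw⟩)
    simp only [Finset.mem_filter, Finset.mem_univ, true_and] at hw hmin
    have h1 := hk w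
    have h2 := hpos w
    have h3 := legs_add_height_le hfib (x := 0) (y := k + 1) w h2 (by omega)
    -- The first ball starts where the earliest shadow does; the loss before position `0` is at most
    -- `ht w` and is paid by the legs below `w`.
    refine ⟨pos w - ht w, ht w - pos w, ⟨⟨fun _ => 0, fun v => Or.inr ?_⟩, by simp, by omega⟩,
      by omega⟩
    by_cases hv : pos v - ht v < 0
    · exact hmin v hv
    · omega
  · push Not at hneg
    exact ⟨0, 0, ⟨⟨fun _ => 0, fun v => Or.inr (hneg v)⟩, by simp, by simp⟩, by omega⟩

include hfib hht hk hspine hpos in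
theorem separable_of_le (hm : 4 * k ^ 2 + 5 * k + 5 ≤ m) : Separable pos ht m := by
  have main : ∀ t : ℕ, t ≤ 2 * k ^ 2 + 1 → Separable pos ht m ∨
      ∃ (U : Finset ℕ) (g : ℕ) (B D x S : ℤ),
      State pos ht m U B D x S ∧ U.card = t ∧ U ⊆ Finset.range (t + g) ∧
      g ≤ 2 * k ∧ ((t + (g - 1) : ℕ) : ℤ) ≤ S ∧ x ≤ B + 2 * m - 1 - 2 * t - 5 * k := by
    intro t
    induction t with
    | zero =>
      intro _
      obtain ⟨B, D, hs, hB⟩ := exists_state_empty (m := m) hfib hk hpos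
      exact Or.inr ⟨∅, 0, B, D, k + 1, 0, hs, rfl, by simp, by omega, by simp, by
        push_cast; omega⟩
    | succ t ih =>
      intro ht'
      rcases ih (by omega) with h | ⟨U, g, B, D, x, S, hs, hcard, hU, hg, hS, hx⟩
      · exact Or.inl h
      · exact hs.separable_or_exists hfib hht hk hspine hpos hcard hU hg hS hx (by omega)
  rcases main _ le_rfl with h | ⟨U, g, B, D, x, S, hs, hcard, hU, hg, hS, hx⟩
  · exact h
  -- After `2k² + 1` rounds the surplus pays `k` for each of the at most `2k` missing balls. By
  -- truncation `g - 1 + 1` is `1` when `g = 0`: with no gap, one further ball is added.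
  · have hkg : k * (g - 1 + 1) ≤ 2 * k ^ 2 + 1 + (g - 1) := by
      rcases Nat.eq_zero_or_pos g with rfl | h
      · have := Nat.le_self_pow two_ne_zero k
        simp only [Nat.zero_sub, zero_add, mul_one]
        omega
      · rw [Nat.sub_add_cancel h]
        nlinarith
    refine hs.separable_of_surplus hfib hk hspine hpos (J := 2 * k ^ 2 + 1 + (g - 1 + 1))
      (by omega) (g - 1) ?_ (by omega) ?_ ?_
    · exact hU.trans (Finset.range_subset_range.2 (by omega))
    · exact_mod_cast (Int.ofNat_le.2 hkg).trans hS
    · omega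

end Procedure

end GraphBurning

/-! ### Burning as covering by balls, and invariance under isomorphism. -/

namespace GraphBurning

section Graphs

open SimpleGraph

variable {V W : Type*} {G : SimpleGraph V} {H : SimpleGraph W}

theorem exists_adj_dist_eq (hG : G.Connected) {u w : V} {d : ℕ} (h : G.dist u w = d + 1) :
    ∃ v, G.Adj u v ∧ G.dist v w = d := by
  obtain ⟨p, hp⟩ := hG.exists_walk_length_eq_dist u w
  cases p with
  | nil => rw [dist_self] at h; omega
  | cons hadj q =>
    rename_i v
    refine ⟨v, hadj, ?_⟩
    have h1 := dist_le q
    have h2 := hG.dist_triangle (u := u) (v := v) (w := w)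
    rw [dist_eq_one_iff_adj.2 hadj] at h2
    rw [Walk.length_cons] at hp
    omega

theorem dist_map_le (hG : G.Connected) (f : G →g H) (u v : V) :
    H.dist (f u) (f v) ≤ G.dist u v := by
  obtain ⟨p, hp⟩ := hG.exists_walk_length_eq_dist u v
  rw [← hp, ← Walk.length_map f p]
  exact dist_le _

/-- The vertices of `G` can be covered by balls of radii `0, …, m - 1`. -/
def IsCoverable (G : SimpleGraph V) (m : ℕ) : Prop :=
  ∃ c : ℕ → V, ∀ w, ∃ i < m, G.dist w (c i) ≤ i

theorem IsCoverable.mono {m n : ℕ} (h : IsCoverable G m) (hmn : m ≤ n) : IsCoverable G n := by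
  obtain ⟨c, hc⟩ := h
  exact ⟨c, fun w => let ⟨i, hi, hw⟩ := hc w; ⟨i, hi.trans_le hmn, hw⟩⟩

theorem spread_mono {S S' : Set V} (h : S ⊆ S') : spread G S ⊆ spread G S' := by
  rintro v (hv | ⟨u, hu, huv⟩)
  · exact Or.inl (h hv)
  · exact Or.inr ⟨u, h hu, huv⟩

theorem mem_fireAfter_iff (hG : G.Connected) (x : ℕ → V) (i : ℕ) (w : V) :
    w ∈ fireAfter G x i ↔ ∃ j < i, G.dist w (x j) + j + 1 ≤ i := by
  induction i generalizing w with
  | zero => simp [fireAfter]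
  | succ i ih =>
    simp only [fireAfter, spread, Set.mem_union, Set.mem_ofPred_eq, Set.mem_singleton_iff, ih]
    constructor
    · rintro ((⟨j, hj, hd⟩ | ⟨u, ⟨j, hj, hd⟩, hu⟩) | rfl)
      · exact ⟨j, by omega, by omega⟩
      · refine ⟨j, by omega, ?_⟩
        have := hG.dist_triangle (u := w) (v := u) (w := x j)
        rw [dist_eq_one_iff_adj.2 hu.symm] at this
        omega
      · exact ⟨i, by omega, by simp⟩
    · rintro ⟨j, hj, hd⟩
      rcases h : G.dist w (x j) with _ | d
      · rw [hG.dist_eq_zero_iff] at h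
        rcases Nat.lt_or_ge j i with hji | hji
        · exact Or.inl (Or.inl ⟨j, hji, by rw [h, dist_self]; omega⟩)
        · exact Or.inr (by rw [h]; congr 1; omega)
      · obtain ⟨v, hv, hvd⟩ := exists_adj_dist_eq hG h
        exact Or.inl (Or.inr ⟨v, ⟨j, by omega, by omega⟩, hv.symm⟩)

/-- The requirement that new fires start at vertices not yet burning does not matter. -/
theorem isBurnable_of_fireAfter_eq_univ {m : ℕ} {x : ℕ → V} (hx : fireAfter G x m = Set.univ) :
    IsBurnable G m := by
  classical
  have hp : ∀ (S : Set V) (v : V), ∃ v', (S ≠ Set.univ → v' ∉ S) ∧ (v ∈ S ∨ v' = v) := by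
    intro S v
    by_cases hv : v ∈ S
    · by_cases h : S = Set.univ
      · exact ⟨v, fun h' => absurd h h', Or.inl hv⟩
      · obtain ⟨v', hv'⟩ := (Set.ne_univ_iff_exists_notMem S).1 h
        exact ⟨v', fun _ => hv', Or.inl hv⟩
    · exact ⟨v, fun _ => hv, Or.inr rfl⟩
  choose pick hpick hpick' using hp
  let s : ℕ → Set V := fun n =>
    Nat.rec ∅ (fun i S => spread G S ∪ {pick (spread G S) (x i)}) n
  let y : ℕ → V := fun n => pick (spread G (s n)) (x n)
  have hs : ∀ n, fireAfter G y n = s n := by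
    intro n
    induction n with
    | zero => rfl
    | succ n ih => simp only [fireAfter, ih]; rfl
  have hsub : ∀ n, fireAfter G x n ⊆ fireAfter G y n := by
    intro n
    induction n with
    | zero => exact subset_rfl
    | succ n ih =>
      -- `y` follows `x` unless that vertex already burns, so its fire always contains that of `x`.
      refine Set.union_subset ((spread_mono ih).trans Set.subset_union_left) ?_
      rw [Set.singleton_subset_iff]
      rcases hpick' (spread G (s n)) (x n) with h | h
      · exact Or.inl (by rwa [hs])
      · exact Or.inr h.symm
  refine ⟨y, fun i _ h => ?_, Set.univ_subset_iff.1 (hx ▸ hsub m)⟩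
  rw [hs] at h ⊢
  exact hpick _ _ h

/-- A fire started at step `j + 1` has radius `m - 1 - j` at the end of step `m`, hence the reversal
of indices. -/
theorem isBurnable_iff (hG : G.Connected) {m : ℕ} : IsBurnable G m ↔ IsCoverable G m := by
  constructor
  · rintro ⟨x, -, hx⟩
    refine ⟨fun i => x (m - 1 - i), fun w => ?_⟩
    obtain ⟨j, hj, hd⟩ := (mem_fireAfter_iff hG x m w).1 (hx ▸ Set.mem_univ w)
    refine ⟨m - 1 - j, by omega, ?_⟩
    simp only [show m - 1 - (m - 1 - j) = j by omega]
    omega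
  · rintro ⟨c, hc⟩
    refine isBurnable_of_fireAfter_eq_univ (x := fun j => c (m - 1 - j))
      (Set.eq_univ_of_forall fun w => (mem_fireAfter_iff hG _ m w).2 ?_)
    obtain ⟨i, hi, hd⟩ := hc w
    refine ⟨m - 1 - i, by omega, ?_⟩
    simp only [show m - 1 - (m - 1 - i) = i by omega]
    omega

theorem burningNumber_le_iff [Finite V] (hG : G.Connected) {m : ℕ} :
    burningNumber G ≤ m ↔ IsCoverable G m := by
  have := hG.nonempty
  constructor
  · intro h
    exact ((isBurnable_iff hG).1 (Nat.sInf_mem (exists_isBurnable G))).mono h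
  · intro h
    exact Nat.sInf_le ((isBurnable_iff hG).2 h)

theorem isKCaterpillar_iff [Finite V] {k : ℕ} :
    IsKCaterpillar k G ↔ G.IsTree ∧ HasSpineWithin G k := by
  refine and_congr_right fun hG => ?_
  have := hG.connected.nonempty
  constructor
  · intro h
    obtain ⟨u, v, p, hp, hw⟩ := Nat.sInf_mem (exists_hasSpineWithin G)
    refine ⟨u, v, p, hp, fun w => ?_⟩
    obtain ⟨z, hz, hd⟩ := hw w
    exact ⟨z, hz, hd.trans h⟩
  · intro h
    exact Nat.sInf_le h

theorem IsKCaterpillar.of_iso [Finite V] {k : ℕ} (e : G ≃g H) (h : IsKCaterpillar k G) :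
    IsKCaterpillar k H := by
  have : Finite W := Finite.of_equiv V e.toEquiv
  rw [isKCaterpillar_iff] at h ⊢
  obtain ⟨hG, u, v, p, hp, hw⟩ := h
  refine ⟨e.isTree_iff.1 hG, e u, e v, p.map e.toHom, Walk.IsPath.map e.injective hp,
    fun w => ?_⟩
  obtain ⟨z, hz, hd⟩ := hw (e.symm w)
  refine ⟨e z, by rw [Walk.support_map]; exact List.mem_map_of_mem hz, ?_⟩
  have := dist_map_le hG.connected e.toHom (e.symm w) z
  rw [show e.toHom (e.symm w) = w from e.apply_symm_apply w] at this
  exact this.trans hd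

theorem IsCoverable.of_iso (hG : G.Connected) (e : G ≃g H) {m : ℕ} (h : IsCoverable G m) :
    IsCoverable H m := by
  obtain ⟨c, hc⟩ := h
  refine ⟨fun i => e (c i), fun w => ?_⟩
  obtain ⟨i, hi, hd⟩ := hc (e.symm w)
  refine ⟨i, hi, ?_⟩
  have := dist_map_le hG e.toHom (e.symm w) (c i)
  rw [show e.toHom (e.symm w) = w from e.apply_symm_apply w] at this
  exact this.trans hd

end Graphs

end GraphBurning

/-! ### Positions and heights relative to a spine. -/

namespace GraphBurning

section Projection

open SimpleGraph

variable {V : Type*} {G : SimpleGraph V} {a b : V} (p : G.Walk a b)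

/-- `i` is the first position on `p` of a vertex closest to `w`. -/
def IsNearest (w : V) (i : ℕ) : Prop :=
  i ≤ p.length ∧ (∀ j ≤ p.length, G.dist w (p.getVert i) ≤ G.dist w (p.getVert j)) ∧
    ∀ j < i, G.dist w (p.getVert i) < G.dist w (p.getVert j)

theorem exists_isNearest (w : V) : ∃ i, IsNearest p w i := by
  classical
  have hex : ∃ i, i ≤ p.length ∧
      ∀ j ≤ p.length, G.dist w (p.getVert i) ≤ G.dist w (p.getVert j) := by
    obtain ⟨i, hi, hmin⟩ := Finset.exists_min_image (Finset.range (p.length + 1))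
      (fun i => G.dist w (p.getVert i)) ⟨0, by simp⟩
    simp only [Finset.mem_range, Nat.lt_succ_iff] at hi hmin
    exact ⟨i, hi, hmin⟩
  obtain ⟨h1, h2⟩ := Nat.find_spec hex
  refine ⟨Nat.find hex, h1, h2, fun j hj => ?_⟩
  by_contra h
  exact Nat.find_min hex hj ⟨by omega, fun l hl => (not_lt.1 h).trans (h2 l hl)⟩

/-- The position of the vertex of `p` to which `w` is attached. -/
noncomputable def proj (w : V) : ℕ := (exists_isNearest p w).choose

/-- The distance from `w` to the path `p`. -/
noncomputable def height (w : V) : ℕ := G.dist w (p.getVert (proj p w))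

variable {p}

theorem isNearest_proj (w : V) : IsNearest p w (proj p w) := (exists_isNearest p w).choose_spec

theorem IsNearest.proj_eq {w : V} {i : ℕ} (h : IsNearest p w i) : proj p w = i := by
  have h' := isNearest_proj (p := p) w
  rcases lt_trichotomy (proj p w) i with hlt | heq | hlt
  · have h1 := h.2.2 _ hlt
    have h2 := h'.2.1 _ h.1
    omega
  · exact heq
  · have h1 := h'.2.2 _ hlt
    have h2 := h.2.1 _ h'.1
    omega

theorem proj_le_length (w : V) : proj p w ≤ p.length := (isNearest_proj w).1

theorem proj_getVert (hG : G.Connected) (hp : p.IsPath) {i : ℕ} (hi : i ≤ p.length) :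
    proj p (p.getVert i) = i := by
  refine IsNearest.proj_eq ⟨hi, fun j _ => by simp, fun j hj => ?_⟩
  rw [dist_self]
  refine hG.pos_dist_of_ne fun h => ?_
  have := hp.getVert_injOn (show i ∈ {i | i ≤ p.length} from hi)
    (show j ∈ {i | i ≤ p.length} from by simp only [Set.mem_ofPred_eq]; omega) h
  omega

theorem height_getVert (hG : G.Connected) (hp : p.IsPath) {i : ℕ} (hi : i ≤ p.length) :
    height p (p.getVert i) = 0 := by
  rw [height, proj_getVert hG hp hi, dist_self]

theorem height_le {k : ℕ} {w z : V} (hz : z ∈ p.support) (hd : G.dist w z ≤ k) :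
    height p w ≤ k := by
  obtain ⟨j, rfl, hj⟩ := Walk.mem_support_iff_exists_getVert.1 hz
  exact ((isNearest_proj w).2.1 j hj).trans hd

/-- A vertex off the path has a neighbour attached at the same place and closer to the path. -/
theorem exists_adj_height_eq (hG : G.Connected) {w : V} {d : ℕ} (h : height p w = d + 1) :
    ∃ v, G.Adj w v ∧ proj p v = proj p w ∧ height p v = d := by
  obtain ⟨v, hv, hd⟩ := exists_adj_dist_eq hG h
  obtain ⟨h1, h2, h3⟩ := isNearest_proj (p := p) w
  have htri : ∀ j, G.dist w (p.getVert j) ≤ 1 + G.dist v (p.getVert j) := fun j => by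
    have := hG.dist_triangle (u := w) (v := v) (w := p.getVert j)
    rwa [dist_eq_one_iff_adj.2 hv] at this
  rw [height] at h
  have hpv : proj p v = proj p w := by
    refine IsNearest.proj_eq ⟨h1, fun j hj => ?_, fun j hj => ?_⟩
    · have := h2 j hj; have := htri j; omega
    · have := h3 j hj; have := htri j; omega
  exact ⟨v, hv, hpv, by rw [height, hpv, hd]⟩

theorem exists_height_eq (hG : G.Connected) (w : V) {d : ℕ} (hd : d ≤ height p w) :
    ∃ v, proj p v = proj p w ∧ height p v = d := by
  obtain ⟨e, he⟩ := Nat.exists_eq_add_of_le hd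
  induction e generalizing w with
  | zero => exact ⟨w, rfl, he⟩
  | succ e ih =>
    rw [← Nat.add_assoc] at he
    obtain ⟨v, -, hpv, hhv⟩ := exists_adj_height_eq hG he
    obtain ⟨u, hu, hu'⟩ := ih v (by omega) hhv
    exact ⟨u, hu.trans hpv, hu'⟩

theorem dist_getVert_add_le (hG : G.Connected) (i d : ℕ) (h : i + d ≤ p.length) :
    G.dist (p.getVert i) (p.getVert (i + d)) ≤ d := by
  induction d with
  | zero => simp
  | succ d ih =>
    have h1 := hG.dist_triangle (u := p.getVert i) (v := p.getVert (i + d))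
      (w := p.getVert (i + d + 1))
    rw [dist_eq_one_iff_adj.2 (p.adj_getVert_succ (show i + d < p.length by omega))] at h1
    have := ih (by omega)
    rw [← Nat.add_assoc]
    omega

theorem dist_getVert_le (hG : G.Connected) (w : V) {j : ℕ} (hj : j ≤ p.length) :
    (G.dist w (p.getVert j) : ℤ) ≤ |(proj p w : ℤ) - j| + height p w := by
  have h1 := hG.dist_triangle (u := w) (v := p.getVert (proj p w)) (w := p.getVert j)
  have h2 : (G.dist (p.getVert (proj p w)) (p.getVert j) : ℤ) ≤ |(proj p w : ℤ) - j| := by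
    have hw := proj_le_length (p := p) w
    rcases le_total (proj p w) j with h | h
    · obtain ⟨d, rfl⟩ := Nat.exists_eq_add_of_le h
      have := dist_getVert_add_le (p := p) hG _ _ hj
      rw [abs_sub_comm]
      refine le_trans ?_ (le_abs_self _)
      omega
    · obtain ⟨d, hd⟩ := Nat.exists_eq_add_of_le h
      have := dist_getVert_add_le (p := p) hG j d (by omega)
      rw [hd, dist_comm]
      refine le_trans ?_ (le_abs_self _)
      omega
  rw [height]
  omega

/-- Removing an initial part of the spine, with everything attached to it, leaves a
`k`-caterpillar. -/
theorem isKCaterpillar_induce [Finite V] {k : ℕ} (hG : G.IsTree) (hp : p.IsPath)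
    (hk : ∀ w, height p w ≤ k) {s : ℕ} (hs : s ≤ p.length) :
    IsKCaterpillar k (G.induce {w | s ≤ proj p w}) := by
  have hconn := hG.connected
  set R : Set V := {w | s ≤ proj p w} with hR
  have hsupp : ∀ x ∈ (p.drop s).support, x ∈ R := by
    intro x hx
    obtain ⟨j, rfl, hj⟩ := Walk.mem_support_iff_exists_getVert.1 hx
    rw [Walk.drop_length] at hj
    rw [Walk.drop_getVert, hR, Set.mem_ofPred_eq, proj_getVert hconn hp (by omega)]
    omega
  set q := (p.drop s).induce R hsupp with hq
  have hqpath : q.IsPath := by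
    refine Walk.IsPath.of_map (f := (Embedding.induce R).toHom) ?_
    rw [hq, Walk.map_induce]
    exact hp.drop s
  -- Descending to the spine does not change the projection, so the walk stays inside `R`.
  have hwalk : ∀ d, ∀ w : R, height p (w : V) = d →
      ∃ z ∈ q.support, ∃ r : (G.induce R).Walk w z, r.length = d := by
    intro d
    induction d with
    | zero =>
      rintro ⟨w, hw⟩ h0
      have hw' : w = p.getVert (proj p w) := by rwa [height, hconn.dist_eq_zero_iff] at h0
      refine ⟨⟨w, hw⟩, ?_, Walk.nil, rfl⟩
      rw [hq, Walk.support_induce, List.mem_attachWith,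
        Walk.mem_support_iff_exists_getVert]
      have hle := proj_le_length (p := p) w
      have hsw : s ≤ proj p w := hw
      refine ⟨proj p w - s, ?_, by rw [Walk.drop_length]; omega⟩
      rw [Walk.drop_getVert, Nat.add_sub_cancel' hsw, ← hw']
    | succ d ih =>
      rintro ⟨w, hw⟩ hd
      obtain ⟨v, hv, hpv, hhv⟩ := exists_adj_height_eq hconn hd
      obtain ⟨z, hz, r, hr⟩ := ih ⟨v, show s ≤ proj p v from hpv ▸ hw⟩ hhv
      exact ⟨z, hz, Walk.cons (by simpa using hv) r, by rw [Walk.length_cons, hr]⟩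
  have hreach : ∀ w : R, (G.induce R).Reachable w
      ⟨p.getVert s, hsupp _ (p.drop s).start_mem_support⟩ := by
    classical
    intro w
    obtain ⟨z, hz, r, -⟩ := hwalk _ w rfl
    exact ⟨r.append (q.takeUntil z hz).reverse⟩
  rw [isKCaterpillar_iff]
  refine ⟨⟨?_, hG.isAcyclic.induce R⟩, _, _, q, hqpath, fun w => ?_⟩
  · have : Nonempty R := ⟨⟨p.getVert s, hsupp _ (p.drop s).start_mem_support⟩⟩
    exact ⟨fun v w => (hreach v).trans (hreach w).symm⟩
  · obtain ⟨z, hz, r, hr⟩ := hwalk _ w rfl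
    exact ⟨z, hz, (dist_le r).trans (hr.trans_le (hk w))⟩

end Projection

end GraphBurning

/-! ### Induction on the number of vertices. -/

namespace GraphBurning

section Reduction

open SimpleGraph

universe u

variable {V : Type u}

/-- The position on a path of length `l` closest to `i`. -/
def clamp (l : ℕ) (i : ℤ) : ℕ := (max 0 (min i l)).toNat

theorem clamp_le (l : ℕ) (i : ℤ) : clamp l i ≤ l := by
  unfold clamp; omega

theorem abs_sub_clamp_le {l j : ℕ} (i : ℤ) (hj : j ≤ l) : |(j : ℤ) - clamp l i| ≤ |(j : ℤ) - i| := by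
  unfold clamp
  rcases le_total (j : ℤ) i with h | h
  · rw [abs_of_nonpos (by omega), abs_of_nonpos (by omega)]; omega
  · rw [abs_of_nonneg (by omega), abs_of_nonneg (by omega)]; omega

/-- A `k`-caterpillar can be covered if all smaller ones can. -/
theorem IsKCaterpillar.isCoverable_of_smaller [Finite V] {k m : ℕ} {G : SimpleGraph V}
    (hG : IsKCaterpillar k G) (hm : 4 * k ^ 2 + 5 * k + 5 ≤ m) (hcard : Nat.card V ≤ m ^ 2)
    (ih : ∀ R : Set V, Nat.card R < Nat.card V → IsKCaterpillar k (G.induce R) →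
      ∀ r, Nat.card R ≤ r ^ 2 → IsCoverable (G.induce R) r) : IsCoverable G m := by
  classical
  have := Fintype.ofFinite V
  obtain ⟨htree, a, b, p, hp, hspine⟩ := isKCaterpillar_iff.1 hG
  have hconn := htree.connected
  have hk : ∀ w, height p w ≤ k := fun w => by
    obtain ⟨z, hz, hd⟩ := hspine w
    exact height_le hz hd
  obtain ⟨J, s, c, hJ, hJm, hc, hs⟩ : Separable (fun w => (proj p w : ℤ))
      (fun w => (height p w : ℤ)) m := by
    refine separable_of_le (k := k) ?_ (fun w => by positivity) (fun w => by exact_mod_cast hk w)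
      ?_ (fun w => by positivity) hm
    · intro w d hd0 hd
      obtain ⟨v, hv1, hv2⟩ := exists_height_eq (p := p) hconn w (d := d.toNat) (by omega)
      exact ⟨v, by omega, by omega⟩
    · intro w i hi0 hi
      have := proj_le_length (p := p) w
      refine ⟨p.getVert i.toNat, ?_, ?_⟩
      · rw [proj_getVert hconn hp (by omega)]; omega
      · rw [height_getVert hconn hp (by omega)]; rfl
  have hball : ∀ w, (proj p w : ℤ) < s →
      ∃ q < J, G.dist w (p.getVert (clamp p.length (c q))) ≤ m - 1 - q := by
    intro w hw
    obtain ⟨q, hq, hd⟩ := hc w hw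
    have hqJ := Finset.mem_range.1 hq
    dsimp only at hd
    refine ⟨q, hqJ, ?_⟩
    have h1 := dist_getVert_le hconn w (clamp_le p.length (c q))
    have h2 := abs_sub_clamp_le (c q) (proj_le_length (p := p) w)
    omega
  by_cases hall : ∀ w, (proj p w : ℤ) < s
  · refine ⟨fun i => p.getVert (clamp p.length (c (m - 1 - i))), fun w => ?_⟩
    obtain ⟨q, hq, hd⟩ := hball w (hall w)
    refine ⟨m - 1 - q, by omega, ?_⟩
    simp only [show m - 1 - (m - 1 - q) = q by omega]
    exact hd
  · have hs' := hs.resolve_left hall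
    push Not at hall
    obtain ⟨v, hv⟩ := hall
    obtain ⟨d, rfl⟩ := Nat.exists_eq_add_of_le hJm
    set R : Set V := {w | s.toNat ≤ proj p w} with hR
    have hRs : ∀ w, w ∈ R ↔ ¬ (proj p w : ℤ) < s := fun w => by
      rw [hR, Set.mem_ofPred_eq]; omega
    have hsplit : Nat.card {w // (proj p w : ℤ) < s} + Nat.card R = Nat.card V := by
      rw [Nat.card_congr (Equiv.subtypeEquivRight hRs), ← Nat.card_sum]
      exact Nat.card_congr (Equiv.sumCompl _)
    have hrem : J * (2 * d + J) ≤ Nat.card {w // (proj p w : ℤ) < s} := by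
      zify
      refine le_trans (le_of_eq ?_) hs'
      push_cast; ring
    have hpos : 0 < J * (2 * d + J) := by positivity
    -- Here `m = J + d`, and `(J + d) ^ 2 - J * (2 * d + J) = d ^ 2`.
    have hRcard : Nat.card R ≤ d ^ 2 := by nlinarith
    have hlen := proj_le_length (p := p) v
    obtain ⟨e, he⟩ := ih R (by omega)
      (isKCaterpillar_induce htree hp hk (s := s.toNat) (by omega)) d hRcard
    have hRconn := (isKCaterpillar_induce htree hp hk (s := s.toNat) (by omega)).1.connected
    -- Radii below `d` cover the rest; the `J` radii from `d` on cover the initial part, with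
    -- centres clamped to the spine.
    refine ⟨fun i => if i < d then (e i : V) else
      p.getVert (clamp p.length (c (J + d - 1 - i))), fun w => ?_⟩
    by_cases hw : (proj p w : ℤ) < s
    · obtain ⟨q, hq, hd⟩ := hball w hw
      refine ⟨J + d - 1 - q, by omega, ?_⟩
      dsimp only
      rw [if_neg (by omega), show J + d - 1 - (J + d - 1 - q) = q by omega]
      exact hd
    · obtain ⟨i, hi, hd⟩ := he ⟨w, (hRs w).2 hw⟩
      refine ⟨i, by omega, ?_⟩
      dsimp only
      rw [if_pos hi]
      exact (dist_map_le hRconn (Embedding.induce R).toHom _ _).trans hd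

/-- Quantifying over all `r` removes the square root and gives the form that the induction uses. -/
theorem burningConjectureHoldsFor_iff [Finite V] {G : SimpleGraph V} (hG : G.Connected) :
    BurningConjectureHoldsFor G ↔ ∀ r, Nat.card V ≤ r ^ 2 → IsCoverable G r := by
  rw [BurningConjectureHoldsFor, burningNumber_le_iff hG]
  constructor
  · intro h r hr
    refine h.mono (Nat.ceil_le.2 ?_)
    rw [Real.sqrt_le_left (by positivity)]
    exact_mod_cast hr
  · intro h
    refine h _ ?_
    have := (Real.sqrt_le_left (by positivity)).1 (Nat.le_ceil √(Nat.card V : ℝ))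
    exact_mod_cast this

theorem IsKCaterpillar.isCoverable {k : ℕ}
    (hsmall : ∀ (m : ℕ) (T : SimpleGraph (Fin m)), m ≤ (4 * k ^ 2 + 5 * k + 4) ^ 2 →
      IsKCaterpillar k T → BurningConjectureHoldsFor T) (n : ℕ) :
    ∀ (V : Type u) [Finite V] (G : SimpleGraph V), Nat.card V = n → IsKCaterpillar k G →
      ∀ r, Nat.card V ≤ r ^ 2 → IsCoverable G r := by
  induction n using Nat.strong_induction_on with
  | _ n ih =>
    intro V _ G hn hG r hr
    by_cases hN : Nat.card V ≤ (4 * k ^ 2 + 5 * k + 4) ^ 2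
    · let e : G ≃g G.map (Finite.equivFin V).toEmbedding := Iso.map (Finite.equivFin V) G
      have hG' := hG.of_iso e
      refine IsCoverable.of_iso hG'.1.connected e.symm
        ((burningConjectureHoldsFor_iff hG'.1.connected).1 (hsmall _ _ hN hG') r ?_)
      rwa [Nat.card_fin]
    · refine hG.isCoverable_of_smaller (m := r) ?_ hr fun R hR hRk =>
        ih _ (hn ▸ hR) R (G.induce R) rfl hRk
      -- A smaller `r` would bound the order by `(4k² + 5k + 4) ^ 2`, the case already treated.
      by_contra h
      exact hN (hr.trans (Nat.pow_le_pow_left (by omega) 2))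

end Reduction

end GraphBurning

theorem mainTheorem4 (k : ℕ) :
    (∀ (V : Type*) [Finite V] (T : SimpleGraph V),
      GraphBurning.IsKCaterpillar k T → GraphBurning.BurningConjectureHoldsFor T) ∨
    ∃ (m : ℕ) (T : SimpleGraph (Fin m)),
      m ≤ (4 * k ^ 2 + 5 * k + 4) ^ 2 ∧
      GraphBurning.IsKCaterpillar k T ∧ ¬ GraphBurning.BurningConjectureHoldsFor T := by
  by_cases h : ∃ (m : ℕ) (T : SimpleGraph (Fin m)),
      m ≤ (4 * k ^ 2 + 5 * k + 4) ^ 2 ∧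
      GraphBurning.IsKCaterpillar k T ∧ ¬ GraphBurning.BurningConjectureHoldsFor T
  · exact Or.inr h
  · push Not at h
    exact Or.inl fun V _ T hT => (GraphBurning.burningConjectureHoldsFor_iff hT.1.connected).2
      (GraphBurning.IsKCaterpillar.isCoverable h _ V T rfl hT)
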